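/- Let $\mathbb D=\{z\in\mathbb C:|z|<1\}$. An inner function on $\mathbb D$ is a bounded analytic function $\varphi$ on $\mathbb D$ whose radial limit $\varphi^*(\zeta)=\lim_{r\to1^-}\varphi(r\zeta)$ exists and has modulus $1$ for Lebesgue-almost every $\zeta\in\partial\mathbb D$. A one-parameter semigroup of inner functions is a family $(\varphi_t)_{t\ge 0}$ of inner functions on $\mathbb D$ such that $\varphi_{t+s}=\varphi_t\varphi_s$ (pointwise product) for all $s,t\ge 0$ and such that $t\in[0,\infty)\mapsto\varphi_t^*$ is weak$^*$ continuous in $L^\infty(\partial\mathbb D,d\theta)$, i.e. $t\mapsto\int_{-\pi}^{\pi}\varphi_t^*(e^{i\theta})g(e^{i\theta})\,d\theta$ is continuous for every $g\in L^1(\partial\mathbb D,d\theta)$. (1) For every one-parameter semigroup $(\varphi_t)_{t\ge0}$ of inner functions on $\mathbb D$ there are a finite positive Borel measure $\mu$ on $\partial\mathbb D$, singular with respect to Lebesgue measure, and a constant $\lambda\in\mathbb R$ such that, for all $t\ge0$ and $z\in\mathbb D$, $$\varphi_t(z)=e^{it\lambda}\exp\left(-t\int_{\partial\mathbb D}\frac{e^{i\theta}+z}{e^{i\theta}-z}\,d\mu(e^{i\theta})\right).\qquad(*)$$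 (2) Conversely, for every finite positive Borel measure $\mu$ on $\partial\mathbb D$ that is singular with respect to Lebesgue measure and every $\lambda\in\mathbb R$, formula $(*)$ defines a one-parameter semigroup of inner functions on $\mathbb D$. (3) If $(\varphi_t)_{t\ge0}$ is a one-parameter semigroup of inner functions given by $(*)$ with $\mu$ and $\lambda$ as above, then all the functions $\varphi_t$ are symmetric, i.e. $\varphi_t(z)=\overline{\varphi_t(\bar z)}$ for all $z\in\mathbb D$ and $t\ge 0$, if and only if $\lambda=0$ and $\mu$ is invariant under the reflection $e^{i\theta}\mapsto e^{-i\theta}$. -/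

import Mathlib

open MeasureTheory Filter Topology Set
open scoped NNReal ENNReal ComplexConjugate

noncomputable section

namespace InnerSemigroup

/-- The circle carries its Borel σ-algebra. -/
instance : MeasurableSpace Circle := borel Circle

instance : BorelSpace Circle := ⟨rfl⟩

/-- Lebesgue (arc length) measure `dθ` on the unit circle `∂𝔻`, of total mass `2π`: the image of
Lebesgue measure on `(-π, π]` under `θ ↦ e^{iθ}`. -/
def circleLebesgue : Measure Circle :=
  ((volume : Measure ℝ).restrict (Ioc (-Real.pi) Real.pi)).map Circle.exp

/-- The boundary function `φ*(ζ) = lim_{r → 1⁻} φ(r ζ)`. -/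
def boundaryValue (φ : ℂ → ℂ) (ζ : Circle) : ℂ :=
  limUnder (𝓝[<] (1 : ℝ)) (fun r : ℝ => φ ((r : ℂ) * (ζ : ℂ)))

/-- `φ` is an inner function on the open unit disk: bounded and analytic there (only the values of
`φ` on the disk matter), with radial limits of modulus one almost everywhere on the circle. -/
structure IsInner (φ : ℂ → ℂ) : Prop where
  analytic : DifferentiableOn ℂ φ (Metric.ball 0 1)
  bounded : ∃ C : ℝ, ∀ z ∈ Metric.ball (0 : ℂ) 1, ‖φ z‖ ≤ C
  unimodular : ∀ᵐ ζ : Circle ∂circleLebesgue,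
    ∃ w : ℂ, Tendsto (fun r : ℝ => φ ((r : ℂ) * (ζ : ℂ))) (𝓝[<] (1 : ℝ)) (𝓝 w) ∧ ‖w‖ = 1

/-- A one-parameter semigroup `φ_t`, `t ≥ 0`, of inner functions: `φ_{t+s} = φ_t φ_s` on the disk,
and `t ↦ φ_t*` is continuous for the weak-* topology `σ(L^∞(∂𝔻, dθ), L¹(∂𝔻, dθ))`, that is,
`t ↦ ∫ φ_t* g dθ` is continuous on `[0, ∞)` for every integrable `g`. -/
structure IsInnerSemigroup (φ : ℝ≥0 → ℂ → ℂ) : Prop where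
  inner : ∀ t, IsInner (φ t)
  mul : ∀ s t, ∀ z ∈ Metric.ball (0 : ℂ) 1, φ (s + t) z = φ s z * φ t z
  weakStarContinuous : ∀ g : Circle → ℂ, Integrable g circleLebesgue →
    Continuous (fun t : ℝ≥0 => ∫ ζ : Circle, boundaryValue (φ t) ζ * g ζ ∂circleLebesgue)

/-- `φ(z) = conj (φ (conj z))` for all `z` in the open unit disk. -/
def IsSymmetric (φ : ℂ → ℂ) : Prop :=
  ∀ z ∈ Metric.ball (0 : ℂ) 1, φ z = conj (φ (conj z))

/-- `e^{itλ} exp(-t ∫ (ζ + z) / (ζ - z) dμ(ζ))`, with `l` in the role of `λ`. -/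
def expFormula (μ : Measure Circle) (l : ℝ) (t : ℝ≥0) (z : ℂ) : ℂ :=
  Complex.exp (Complex.I * (t : ℝ) * l) *
    Complex.exp (-((t : ℝ) : ℂ) * ∫ ζ : Circle, ((ζ : ℂ) + z) / ((ζ : ℂ) - z) ∂μ)

/-- The measure is invariant under complex conjugation `e^{iθ} ↦ e^{-iθ}`, which on the unit circle
is the group inversion. -/
def IsConjInvariant (μ : Measure Circle) : Prop :=
  μ.map (fun ζ : Circle => ζ⁻¹) = μ

end InnerSemigroup

end

namespace InnerSemigroup

/-! At a fixed point `z` of the disk, `t ↦ φ_t(z)` is a scalar semigroup. An inner function is the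
Poisson integral of its boundary values, so weak* continuity tested against the Poisson kernel makes
this semigroup continuous, and `‖φ_t(z)‖ ≤ 1`. Hence `φ_t(z) = exp(t a(z))` with `a = 1 - 1/L`,
where `L(z)` is the Laplace transform of `t ↦ φ_t(z)` at `1` (`semigroup_eq_exp`). This formula
makes `a` holomorphic with no choice of logarithm, and contractivity gives `Re a ≤ 0`; Herglotz'
theorem applied to `-a` yields `μ` and `λ`.

Singularity of `μ` and unimodularity of the boundary values are linked by Fatou's theorem
(`ae_tendsto_integral_poissonKernel`): `log |φ_1|` is minus the Poisson integral of `μ`, whose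
radial limit is `2π dμ/dθ` almost everywhere. It vanishes exactly when `|φ_1*| = 1`. For the
converse direction the radial limits of the exponent itself are needed
(`ae_exists_tendsto_generator`).

For symmetry, conjugation replaces `(μ, λ)` by the reflected measure and `-λ`, and a measure is
determined by its Herglotz transform. -/

/-! ### Arc length and Besicovitch covering on the circle -/

instance : IsFiniteMeasure circleLebesgue := by
  unfold circleLebesgue; infer_instance

/-- A satellite configuration involves only distances between centers and radii, so one in the
circle is one in `ℂ`, with the same `N` and `τ`. -/
instance : HasBesicovitchCovering Circle := by
  obtain ⟨N, τ, hτ, h⟩ := HasBesicovitchCovering.no_satelliteConfig (α := ℂ)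
  refine ⟨N, τ, hτ, ⟨fun a => h.false ?_⟩⟩
  exact ⟨fun i => a.c i, a.r, a.rpos, a.h, a.hlast, a.inter⟩

theorem integral_circleLebesgue {E : Type*} [NormedAddCommGroup E] [NormedSpace ℝ E] (f : ℂ → E)
    (hf : AEStronglyMeasurable (fun ζ : Circle => f ζ) circleLebesgue) :
    ∫ ζ : Circle, f ζ ∂circleLebesgue = (2 * Real.pi) • Real.circleAverage f 0 1 := by
  have h2 : (2 * Real.pi) ≠ 0 := by positivity
  rw [Real.circleAverage_eq_integral_add (-Real.pi), smul_smul, mul_inv_cancel₀ h2, one_smul,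
    circleLebesgue, integral_map Circle.exp.continuous.aemeasurable hf,
    intervalIntegral.integral_comp_add_right (fun θ => f (circleMap 0 1 θ)),
    show 0 + -Real.pi = -Real.pi by ring, show 2 * Real.pi + -Real.pi = Real.pi by ring,
    intervalIntegral.integral_of_le (by linarith [Real.pi_pos])]
  simp [circleMap]

/-! ### Poisson kernel and Fatou's theorem -/

/-- The Poisson kernel of the disk, as a function of the chordal distance to `ζ`. -/
noncomputable def radialKernel (r s : ℝ) : ℝ := (1 - r ^ 2) / ((1 - r) ^ 2 + r * s ^ 2)

theorem poissonKernel_eq_radialKernel (r : ℝ) (ζ η : Circle) :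
    poissonKernel 0 (r * ζ) η = radialKernel r (dist η ζ) := by
  have hζ : (ζ : ℂ).re ^ 2 + (ζ : ℂ).im ^ 2 = 1 := by
    have := Circle.normSq_coe ζ; rw [Complex.normSq_apply] at this; linarith
  have hη : (η : ℂ).re ^ 2 + (η : ℂ).im ^ 2 = 1 := by
    have := Circle.normSq_coe η; rw [Complex.normSq_apply] at this; linarith
  have hd : dist η ζ = ‖(η : ℂ) - ζ‖ := dist_eq_norm (η : ℂ) ζ
  rw [poissonKernel, radialKernel, hd]
  congr 1
  · simp [Circle.norm_coe]
  · rw [← Complex.normSq_eq_norm_sq, ← Complex.normSq_eq_norm_sq, Complex.normSq_apply,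
      Complex.normSq_apply]
    simp
    linear_combination (r ^ 2 - r) * hζ + (1 - r) * hη

theorem radialKernel_nonneg {r : ℝ} (h0 : 0 < r) (h1 : r < 1) (s : ℝ) :
    0 ≤ radialKernel r s :=
  div_nonneg (by nlinarith) (by positivity)

theorem continuous_radialKernel {r : ℝ} (h0 : 0 < r) (h1 : r < 1) :
    Continuous (radialKernel r) := by
  unfold radialKernel
  refine continuous_const.div (by fun_prop) fun s => ?_
  have : 0 < (1 - r) ^ 2 := by have : 0 < 1 - r := by linarith
                               positivity
  positivity

theorem tendsto_radialKernel {s : ℝ} (hs : 0 < s) :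
    Tendsto (fun r => radialKernel r s) (𝓝[<] 1) (𝓝 0) := by
  have : ContinuousAt (fun r => radialKernel r s) 1 := by
    unfold radialKernel
    refine ContinuousAt.div (by fun_prop) (by fun_prop) ?_
    simp [hs.ne']
  have h := this.tendsto
  simp only [radialKernel] at h
  norm_num at h
  exact h.mono_left nhdsWithin_le_nhds

/-- Superlevel sets of the truncated kernel are small balls, so a comparison of two measures on
small balls gives a comparison of the integrals. -/
theorem integral_truncated_le {ρ σ : Measure Circle} [IsFiniteMeasure ρ] [IsFiniteMeasure σ]
    {ζ : Circle} {δ r : ℝ} (hδ : 0 < δ) (h0 : 0 < r) (h1 : r < 1)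
    (h : ∀ s, 0 < s → s ≤ δ → ρ (Metric.closedBall ζ s) ≤ σ (Metric.closedBall ζ s)) :
    ∫ η, max (radialKernel r (dist η ζ) - radialKernel r δ) 0 ∂ρ ≤
      ∫ η, max (radialKernel r (dist η ζ) - radialKernel r δ) 0 ∂σ := by
  have hr : 0 < 1 - r := by linarith
  have hcont : Continuous fun η : Circle => max (radialKernel r (dist η ζ) - radialKernel r δ) 0 :=
    (((continuous_radialKernel h0 h1).comp (by fun_prop)).sub continuous_const).max continuous_const
  have hint : ∀ τ : Measure Circle, IsFiniteMeasure τ →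
      Integrable (fun η : Circle => max (radialKernel r (dist η ζ) - radialKernel r δ) 0) τ :=
    fun τ _ => hcont.integrable_of_hasCompactSupport (HasCompactSupport.of_compactSpace _)
  have hnn : 0 ≤ fun η : Circle => max (radialKernel r (dist η ζ) - radialKernel r δ) 0 :=
    fun η => le_max_right _ _
  rw [← ENNReal.ofReal_le_ofReal_iff (integral_nonneg hnn),
    ofReal_integral_eq_lintegral_ofReal (hint ρ ‹_›) (ae_of_all _ hnn),
    ofReal_integral_eq_lintegral_ofReal (hint σ ‹_›) (ae_of_all _ hnn),
    lintegral_eq_lintegral_meas_le _ (ae_of_all _ hnn) hcont.aemeasurable,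
    lintegral_eq_lintegral_meas_le _ (ae_of_all _ hnn) hcont.aemeasurable]
  refine lintegral_mono_ae ?_
  -- At this one level the superlevel set is `{ζ}`, a ball of radius zero, about which `h` says
  -- nothing.
  have hne : ∀ᵐ t : ℝ ∂(volume.restrict (Ioi 0)), t ≠ radialKernel r 0 - radialKernel r δ :=
    ae_restrict_of_ae (compl_mem_ae_iff.2 (measure_singleton _))
  filter_upwards [hne, ae_restrict_mem measurableSet_Ioi] with t htn ht
  rw [mem_Ioi] at ht
  have hc : 0 < t + radialKernel r δ := by
    have := radialKernel_nonneg h0 h1 δ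
    linarith
  set c := t + radialKernel r δ with hcdef
  -- The kernel decreases in the distance; `b` is the squared distance at which it equals `c`.
  set b := ((1 - r ^ 2) / c - (1 - r) ^ 2) / r with hb
  have hset : ∀ s, t ≤ max (radialKernel r s - radialKernel r δ) 0 ↔ s ^ 2 ≤ b := by
    intro s
    have hden : 0 < (1 - r) ^ 2 + r * s ^ 2 := by positivity
    rw [le_max_iff, or_iff_left (not_le.2 ht), le_sub_iff_add_le, ← hcdef, radialKernel,
      le_div_iff₀ hden, hb, le_div_iff₀ h0, le_sub_iff_add_le (b := (1 - r) ^ 2), le_div_iff₀ hc]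
    constructor <;> intro h <;> nlinarith
  simp only [hset]
  rcases lt_trichotomy b 0 with hb0 | hb0 | hb0
  · have : {a : Circle | dist a ζ ^ 2 ≤ b} = ∅ := by
      ext a
      simp only [mem_ofPred_eq, mem_empty_iff_false, iff_false, not_le]
      exact hb0.trans_le (sq_nonneg _)
    simp [this]
  · exfalso
    apply htn
    rw [hb, div_eq_zero_iff, or_iff_left h0.ne', sub_eq_zero, div_eq_iff hc.ne'] at hb0
    have : radialKernel r 0 = c := by
      rw [radialKernel, div_eq_iff (by positivity)]
      linarith
    rw [this, hcdef]; ring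
  · have : {a : Circle | dist a ζ ^ 2 ≤ b} = Metric.closedBall ζ (Real.sqrt b) := by
      ext a
      rw [mem_ofPred_eq, Metric.mem_closedBall, Real.le_sqrt dist_nonneg hb0.le]
    rw [this]
    refine h _ (Real.sqrt_pos.2 hb0) ?_
    -- The truncated kernel vanishes at distance `δ`, so a superlevel set with `t > 0` cannot extend
    -- that far.
    by_contra! hlt
    have h2 := (hset δ).2 ((Real.lt_sqrt hδ.le).1 hlt).le
    rw [sub_self, max_self] at h2
    exact absurd h2 (not_le.2 ht)

theorem continuous_poissonKernel {z : ℂ} (hz : z ∈ Metric.ball (0 : ℂ) 1) :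
    Continuous fun ζ : Circle => poissonKernel 0 z ζ := by
  unfold poissonKernel
  refine Continuous.div (by fun_prop) (by fun_prop) fun ζ => ?_
  have : (ζ : ℂ) ≠ z := by rintro rfl; simp [Circle.norm_coe] at hz
  simpa [sub_eq_zero] using this

theorem poissonKernel_nonneg {z : ℂ} (hz : z ∈ Metric.ball (0 : ℂ) 1) (ζ : Circle) :
    0 ≤ poissonKernel 0 z ζ := by
  unfold poissonKernel
  have : ‖z‖ < 1 := by simpa using hz
  refine div_nonneg ?_ (by positivity)
  have := norm_nonneg z
  simp [Circle.norm_coe]; nlinarith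

theorem _root_.Continuous.integrable_of_compactSpace {X E : Type*} [TopologicalSpace X]
    [CompactSpace X] [MeasurableSpace X] [OpensMeasurableSpace X]
    [NormedAddCommGroup E] [SecondCountableTopologyEither X E]
    {f : X → E} (hf : Continuous f) (μ : Measure X) [IsFiniteMeasure μ] : Integrable f μ :=
  hf.integrable_of_hasCompactSupport (HasCompactSupport.of_compactSpace _)

theorem integral_poissonKernel {z : ℂ} (hz : z ∈ Metric.ball (0 : ℂ) 1) :
    ∫ ζ : Circle, poissonKernel 0 z ζ ∂circleLebesgue = 2 * Real.pi := by
  rw [integral_circleLebesgue (poissonKernel 0 z)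
    (continuous_poissonKernel hz).aestronglyMeasurable]
  have h := (diffContOnCl_const (c := (1 : ℂ)) (𝕜 := ℂ)
    (s := Metric.ball (0 : ℂ) 1)).circleAverage_poissonKernel_smul hz
  have h2 : ((Real.circleAverage (poissonKernel 0 z) 0 1 : ℝ) : ℂ) = 1 := by
    rw [← h, Real.circleAverage_def, Real.circleAverage_def]
    simp
    exact intervalIntegral.integral_ofReal.symm
  have h3 : Real.circleAverage (poissonKernel 0 z) 0 1 = 1 := by exact_mod_cast h2
  rw [h3]; simp

theorem real_mul_coe_mem_ball {r : ℝ} (h0 : 0 < r) (h1 : r < 1) (ζ : Circle) :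
    (r * ζ : ℂ) ∈ Metric.ball (0 : ℂ) 1 := by
  simpa [abs_of_pos h0, Circle.norm_coe] using h1

theorem eventually_nhdsLT_one : ∀ᶠ r : ℝ in 𝓝[<] 1, 0 < r ∧ r < 1 :=
  Ioo_mem_nhdsLT one_pos

/-- **Fatou's theorem** for Poisson integrals of finite measures. -/
theorem ae_tendsto_integral_poissonKernel (ν : Measure Circle) [IsFiniteMeasure ν] :
    ∀ᵐ ζ : Circle ∂circleLebesgue,
      Tendsto (fun r : ℝ => ∫ η : Circle, poissonKernel 0 (r * ζ) η ∂ν) (𝓝[<] 1)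
        (𝓝 (2 * Real.pi * (ν.rnDeriv circleLebesgue ζ).toReal)) := by
  filter_upwards [Besicovitch.ae_tendsto_rnDeriv ν circleLebesgue,
    Measure.rnDeriv_ne_top ν circleLebesgue] with ζ hζ hfin
  lift ν.rnDeriv circleLebesgue ζ to ℝ≥0 using hfin with D hD
  simp only [ENNReal.coe_toReal]
  simp only [poissonKernel_eq_radialKernel]
  set N := ν.real univ with hN
  have hN0 : 0 ≤ N := measureReal_nonneg
  -- Comparing `ν` with `(D ± ε) dθ` on small balls costs `2πε`; truncating at a kernel value below
  -- `ε` costs `Nε` in the upper bound and `2πDε` in the lower one.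
  have key : ∀ ε : ℝ≥0, 0 < ε → ε ≤ 1 → ∀ᶠ r : ℝ in 𝓝[<] 1,
      |(∫ η : Circle, radialKernel r (dist η ζ) ∂ν) - 2 * Real.pi * D| ≤
        (2 * Real.pi + N + 2 * Real.pi * D) * ε := by
    intro ε hε hε1
    have e1 : ∀ᶠ s in 𝓝[>] (0:ℝ), ν (Metric.closedBall ζ s) / circleLebesgue (Metric.closedBall ζ s)
        ≤ ((D + ε : ℝ≥0) : ℝ≥0∞) := by
      refine (hζ.eventually (gt_mem_nhds ?_)).mono fun s hs => le_of_lt hs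
      exact_mod_cast lt_add_of_pos_right D hε
    have e2 : ∀ᶠ s in 𝓝[>] (0:ℝ), ((D - ε : ℝ≥0) : ℝ≥0∞) * circleLebesgue (Metric.closedBall ζ s) ≤
        ν (Metric.closedBall ζ s) := by
      rcases le_or_gt D ε with hle | hlt
      · simp [tsub_eq_zero_of_le hle]
      · refine (hζ.eventually (lt_mem_nhds (a := ((D - ε : ℝ≥0) : ℝ≥0∞)) ?_)).mono
          fun s hs => ENNReal.mul_le_of_le_div hs.le
        exact_mod_cast tsub_lt_self (hε.trans hlt) hε
    obtain ⟨δ, hδ, hball⟩ := (mem_nhdsGT_iff_exists_Ioc_subset).1 (e1.and e2)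
    rw [mem_Ioi] at hδ
    filter_upwards [eventually_nhdsLT_one,
      (tendsto_radialKernel hδ).eventually (gt_mem_nhds (show (0:ℝ) < ε from hε))] with r hr hkε
    obtain ⟨h0, h1⟩ := hr
    have hk0 := radialKernel_nonneg h0 h1 δ
    set k := radialKernel r δ
    have hkc : Continuous fun η : Circle => radialKernel r (dist η ζ) :=
      (continuous_radialKernel h0 h1).comp (by fun_prop)
    have hmc : Continuous fun η : Circle => max (radialKernel r (dist η ζ) - k) 0 :=
      (hkc.sub continuous_const).max continuous_const
    have up := integral_truncated_le (ρ := ν) (σ := (D + ε) • circleLebesgue) hδ h0 h1 (by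
      intro s hs hsδ
      have := (hball ⟨hs, hsδ⟩).1
      rw [ENNReal.div_le_iff_le_mul (Or.inr ENNReal.coe_ne_top)
        (Or.inl (measure_ne_top _ _))] at this
      simpa [ENNReal.smul_def] using this)
    have lo := integral_truncated_le (ρ := (D - ε) • circleLebesgue) (σ := ν) hδ h0 h1 (by
      intro s hs hsδ
      have := (hball ⟨hs, hsδ⟩).2
      simpa [ENNReal.smul_def] using this)
    rw [integral_smul_nnreal_measure] at up lo
    have hM : ∫ η : Circle, radialKernel r (dist η ζ) ∂circleLebesgue = 2 * Real.pi := by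
      simp only [← poissonKernel_eq_radialKernel]
      exact integral_poissonKernel (real_mul_coe_mem_ball h0 h1 ζ)
    have hmass : circleLebesgue.real univ = 2 * Real.pi := by
      have := integral_poissonKernel (z := 0) (by simp)
      simpa [poissonKernel] using this
    -- truncation changes integrals by at most `k` times the total mass
    have tr1 : ∀ τ : Measure Circle, IsFiniteMeasure τ →
        ∫ η, max (radialKernel r (dist η ζ) - k) 0 ∂τ ≤
          ∫ η : Circle, radialKernel r (dist η ζ) ∂τ := by
      intro τ _
      refine integral_mono (hmc.integrable_of_compactSpace τ) (hkc.integrable_of_compactSpace τ)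
        fun η => ?_
      have := radialKernel_nonneg h0 h1 (dist η ζ)
      simp [this, hk0]
    have tr2 : ∀ τ : Measure Circle, IsFiniteMeasure τ →
        ∫ η : Circle, radialKernel r (dist η ζ) ∂τ ≤
          (∫ η, max (radialKernel r (dist η ζ) - k) 0 ∂τ) + k * τ.real univ := by
      intro τ _
      have : ∫ η : Circle, (max (radialKernel r (dist η ζ) - k) 0 + k) ∂τ =
          (∫ η, max (radialKernel r (dist η ζ) - k) 0 ∂τ) + k * τ.real univ := by
        rw [integral_add (hmc.integrable_of_compactSpace τ) (integrable_const _)]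
        simp [mul_comm]
      rw [← this]
      refine integral_mono (hkc.integrable_of_compactSpace τ)
        ((hmc.add continuous_const).integrable_of_compactSpace τ) fun η => ?_
      have := le_max_left (radialKernel r (dist η ζ) - k) 0
      simp only; linarith
    have a1 := tr1 circleLebesgue inferInstance
    have a2 := tr2 circleLebesgue inferInstance
    have a3 := tr1 ν inferInstance
    have a4 := tr2 ν inferInstance
    rw [hM] at a1 a2
    rw [hmass] at a2
    set T := ∫ η, max (radialKernel r (dist η ζ) - k) 0 ∂circleLebesgue
    set S := ∫ η, max (radialKernel r (dist η ζ) - k) 0 ∂ν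
    have up' : S ≤ (D + ε) * T := by simpa [NNReal.smul_def] using up
    have hT0 : 0 ≤ T := integral_nonneg fun η => le_max_right _ _
    have lo' : (D - ε) * T ≤ S := by
      refine le_trans ?_ lo
      rw [NNReal.smul_def, smul_eq_mul]
      gcongr
      exact NNReal.coe_sub_def ▸ le_max_left _ _
    have hε0 : (0:ℝ) < ε := hε
    have hε1' : (ε:ℝ) ≤ 1 := hε1
    have hD0 : (0:ℝ) ≤ D := D.2
    have hpi := Real.pi_pos
    rw [abs_le]
    constructor
    · have b1 : (D:ℝ) * T ≥ D * (2 * Real.pi - ε * (2 * Real.pi)) := by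
        gcongr
        nlinarith
      have b2 : (ε:ℝ) * T ≤ ε * (2 * Real.pi) := by gcongr
      nlinarith
    · have b1 : (D + ε) * T ≤ (D + ε) * (2 * Real.pi) := by gcongr
      have b2 : k * N ≤ ε * N := by gcongr
      have b3 : 0 ≤ 2 * Real.pi * D * ε := by positivity
      nlinarith
  rw [Metric.tendsto_nhds]
  intro η hη
  set C := 2 * Real.pi + N + 2 * Real.pi * D with hC
  have hC0 : 0 < C := by have := Real.pi_pos; have : (0:ℝ) ≤ D := D.2; positivity
  have hmin : 0 < min 1 (η / (2 * C)) := by positivity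
  filter_upwards [key (min 1 (η / (2 * C))).toNNReal (Real.toNNReal_pos.2 hmin)
    (Real.toNNReal_le_one.2 (min_le_left _ _))] with r hr
  rw [Real.dist_eq]
  refine hr.trans_lt ?_
  have : C * min 1 (η / (2 * C)) ≤ C * (η / (2 * C)) := by gcongr; exact min_le_right _ _
  have h2 : C * (η / (2 * C)) = η / 2 := by field_simp
  rw [Real.coe_toNNReal _ hmin.le]
  linarith

/-! ### Herglotz representation -/

theorem continuous_radial {f : ℂ → ℂ} (hf : DifferentiableOn ℂ f (Metric.ball 0 1))
    {r : ℝ} (h0 : 0 < r) (h1 : r < 1) : Continuous fun ζ : Circle => f (r * ζ) :=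
  hf.continuousOn.comp_continuous (by fun_prop) fun ζ => real_mul_coe_mem_ball h0 h1 ζ

/-- The dilate `f (r * ·)` is holomorphic up to the boundary, so Poisson's formula applies although
`f` itself need not extend. -/
theorem integral_poissonKernel_mul {f : ℂ → ℂ} (hf : DifferentiableOn ℂ f (Metric.ball 0 1))
    {r : ℝ} (h0 : 0 < r) (h1 : r < 1) {z : ℂ} (hz : z ∈ Metric.ball (0 : ℂ) 1) :
    ∫ ζ : Circle, (poissonKernel 0 z ζ : ℂ) * f (r * ζ) ∂circleLebesgue =
      2 * Real.pi * f (r * z) := by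
  have hmaps : MapsTo (fun z : ℂ => (r : ℂ) * z) (Metric.closedBall 0 1) (Metric.ball 0 1) := by
    intro w hw
    simp only [mem_closedBall_zero_iff, mem_ball_zero_iff, norm_mul, Complex.norm_real,
      Real.norm_eq_abs, abs_of_pos h0] at hw ⊢
    nlinarith [norm_nonneg w]
  have hd : DiffContOnCl ℂ (fun w => f (r * w)) (Metric.ball 0 1) := by
    refine DifferentiableOn.diffContOnCl ?_
    rw [closure_ball _ one_ne_zero]
    exact hf.comp (by fun_prop) hmaps
  have h := hd.circleAverage_poissonKernel_smul hz
  rw [integral_circleLebesgue (fun ζ => (poissonKernel 0 z ζ : ℂ) * f (r * ζ))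
    (((Complex.continuous_ofReal.comp (continuous_poissonKernel hz)).mul
      (continuous_radial hf h0 h1)).aestronglyMeasurable),
    ← h]
  simp only [Complex.real_smul, Complex.ofReal_mul, Complex.ofReal_ofNat]
  congr 2

theorem re_mul_integral_poissonKernel {f : ℂ → ℂ} (hf : DifferentiableOn ℂ f (Metric.ball 0 1))
    {r : ℝ} (h0 : 0 < r) (h1 : r < 1) {z : ℂ} (hz : z ∈ Metric.ball (0 : ℂ) 1) :
    ∫ ζ : Circle, ((2 * Real.pi)⁻¹ * (f (r * ζ)).re) * poissonKernel 0 z ζ ∂circleLebesgue =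
      (f (r * z)).re := by
  have h := integral_poissonKernel_mul hf h0 h1 hz
  have hint : Integrable (fun ζ : Circle => (poissonKernel 0 z ζ : ℂ) * f (r * ζ))
      circleLebesgue :=
    ((Complex.continuous_ofReal.comp (continuous_poissonKernel hz)).mul
      (continuous_radial hf h0 h1)).integrable_of_compactSpace _
  have h2 := Complex.reCLM.integral_comp_comm hint
  rw [h] at h2
  have h3 : Complex.reCLM (2 * Real.pi * f (r * z)) = 2 * Real.pi * (f (r * z)).re := by
    rw [← Complex.ofReal_ofNat, ← Complex.ofReal_mul, Complex.reCLM_apply, Complex.re_ofReal_mul]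
  rw [h3] at h2
  simp only [Complex.reCLM_apply, Complex.re_ofReal_mul] at h2
  have : ∀ ζ : Circle, (2 * Real.pi)⁻¹ * (f (r * ζ)).re * poissonKernel 0 z ζ =
      (2 * Real.pi)⁻¹ * (poissonKernel 0 z ζ * (f (r * ζ)).re) := fun ζ => by ring
  simp only [this]
  rw [integral_const_mul, h2, ← mul_assoc, inv_mul_cancel₀ (by positivity), one_mul]

/-- **Herglotz' theorem**: a harmonic function that is the nonnegative real part of a holomorphic
function on the disk is the Poisson integral of a finite measure. -/
theorem exists_measure_re_eq_integral {f : ℂ → ℂ} (hf : DifferentiableOn ℂ f (Metric.ball 0 1))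
    (hre : ∀ z ∈ Metric.ball (0 : ℂ) 1, 0 ≤ (f z).re) :
    ∃ μ : Measure Circle, IsFiniteMeasure μ ∧ ∀ z ∈ Metric.ball (0 : ℂ) 1,
      (f z).re = ∫ ζ : Circle, poissonKernel 0 z ζ ∂μ := by
  obtain ⟨r, -, hr, hrlim⟩ := exists_seq_strictMono_tendsto' (show (0 : ℝ) < 1 from one_pos)
  set g : ℕ → Circle → ℝ := fun n ζ => (2 * Real.pi)⁻¹ * (f (r n * ζ)).re with hg
  have hgc : ∀ n, Continuous (g n) := fun n => continuous_const.mul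
    (Complex.continuous_re.comp (continuous_radial hf (hr n).1 (hr n).2))
  have hg0 : ∀ n ζ, 0 ≤ g n ζ := fun n ζ =>
    mul_nonneg (by positivity) (hre _ (real_mul_coe_mem_ball (hr n).1 (hr n).2 ζ))
  set m : ℕ → Measure Circle := fun n =>
    circleLebesgue.withDensity fun ζ => ENNReal.ofReal (g n ζ) with hm
  have hfin : ∀ n, IsFiniteMeasure (m n) := fun n =>
    isFiniteMeasure_withDensity_ofReal ((hgc n).integrable_of_compactSpace _).2
  have hint : ∀ n, ∀ z ∈ Metric.ball (0 : ℂ) 1,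
      ∫ ζ : Circle, poissonKernel 0 z ζ ∂(m n) = (f (r n * z)).re := by
    intro n z hz
    rw [← re_mul_integral_poissonKernel hf (hr n).1 (hr n).2 hz]
    have := integral_withDensity_eq_integral_smul (μ := circleLebesgue)
      (f := fun ζ => (g n ζ).toNNReal) (hgc n).measurable.real_toNNReal
      (fun ζ : Circle => poissonKernel 0 z ζ)
    refine this.trans (integral_congr_ae (ae_of_all _ fun ζ => ?_))
    simp only [NNReal.smul_def, Real.coe_toNNReal _ (hg0 n ζ), smul_eq_mul]
    rfl
  set M : ℕ → FiniteMeasure Circle := fun n => ⟨m n, hfin n⟩ with hM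
  set C : ℝ≥0 := (f 0).re.toNNReal
  have hmass : ∀ n, (M n).mass = C := by
    intro n
    have h := hint n 0 (by simp)
    have hk : ∀ ζ : Circle, poissonKernel 0 0 (ζ : ℂ) = 1 := fun ζ => by
      simp [poissonKernel, Circle.norm_coe]
    simp only [hk, integral_const, smul_eq_mul, mul_one, mul_zero] at h
    rw [← NNReal.coe_inj, Real.coe_toNNReal _ (hre 0 (by simp)), ← h]
    rfl
  have hcpt := isCompact_setOfPred_finiteMeasure_eq_of_compactSpace Circle C
  -- All approximating measures have mass `Re f(0)`, hence lie in a weakly compact set; a limit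
  -- along an ultrafilter finer than `atTop` replaces a convergent subsequence.
  obtain ⟨ν, -, hν⟩ := hcpt.ultrafilter_le_nhds ((hyperfilter ℕ).map M) (by
    rw [Ultrafilter.coe_map, le_principal_iff, mem_map]
    exact univ_mem' hmass)
  have hν' : Tendsto M (hyperfilter ℕ : Filter ℕ) (𝓝 ν) := hν
  have hle : (hyperfilter ℕ : Filter ℕ) ≤ atTop := Nat.cofinite_eq_atTop ▸ hyperfilter_le_cofinite
  refine ⟨ν, inferInstance, fun z hz => ?_⟩
  have h1 := FiniteMeasure.tendsto_iff_forall_integral_tendsto.1 hν'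
    (BoundedContinuousFunction.mkOfCompact
      (⟨fun ζ : Circle => poissonKernel 0 z ζ, continuous_poissonKernel hz⟩ : C(Circle, ℝ)))
  have h2 : Tendsto (fun n => (f (r n * z)).re) atTop (𝓝 (f z).re) := by
    have hcz : ContinuousAt f z := hf.continuousOn.continuousAt (Metric.isOpen_ball.mem_nhds hz)
    refine (Complex.continuous_re.tendsto _).comp (hcz.tendsto.comp ?_)
    have : Tendsto (fun n => (r n : ℂ) * z) atTop (𝓝 ((1 : ℝ) * z)) :=
      ((Complex.continuous_ofReal.tendsto _).comp hrlim).mul_const z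
    simpa using this
  refine tendsto_nhds_unique (h2.mono_left hle) (h1.congr fun n => ?_)
  exact hint n z hz

theorem herglotzRieszKernel_zero (z : ℂ) (ζ : ℂ) :
    herglotzRieszKernel 0 z ζ = (ζ + z) / (ζ - z) := by
  simp [herglotzRieszKernel]

theorem coe_sub_ne_zero {z : ℂ} (hz : z ∈ Metric.ball (0 : ℂ) 1) (ζ : Circle) :
    (ζ : ℂ) - z ≠ 0 := by
  rw [sub_ne_zero]
  rintro rfl
  simp [Circle.norm_coe] at hz

theorem continuous_herglotzKernel {z : ℂ} (hz : z ∈ Metric.ball (0 : ℂ) 1) :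
    Continuous fun ζ : Circle => ((ζ : ℂ) + z) / ((ζ : ℂ) - z) :=
  Continuous.div (by fun_prop) (by fun_prop) (coe_sub_ne_zero hz)

theorem re_integral_herglotzKernel (μ : Measure Circle) [IsFiniteMeasure μ] {z : ℂ}
    (hz : z ∈ Metric.ball (0 : ℂ) 1) :
    (∫ ζ : Circle, ((ζ : ℂ) + z) / ((ζ : ℂ) - z) ∂μ).re = ∫ ζ : Circle, poissonKernel 0 z ζ ∂μ := by
  have := Complex.reCLM.integral_comp_comm
    ((continuous_herglotzKernel hz).integrable_of_compactSpace μ)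
  rw [Complex.reCLM_apply] at this
  rw [← this, poissonKernel_eq_re_herglotzRieszKernel]
  simp [herglotzRieszKernel_zero]

theorem differentiableOn_integral_herglotzKernel (μ : Measure Circle) [IsFiniteMeasure μ] :
    DifferentiableOn ℂ (fun z => ∫ ζ : Circle, ((ζ : ℂ) + z) / ((ζ : ℂ) - z) ∂μ)
      (Metric.ball 0 1) := by
  intro z₀ hz₀
  have hz₀' : ‖z₀‖ < 1 := by simpa using hz₀
  -- Half the distance from `z₀` to the circle: points of `ball z₀ d` remain at distance at least
  -- `d` from the circle.
  set d := (1 - ‖z₀‖) / 2 with hd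
  have hd0 : 0 < d := by rw [hd]; linarith
  have hsub : ∀ z ∈ Metric.ball z₀ d, z ∈ Metric.ball (0 : ℂ) 1 := by
    intro z hz
    rw [mem_ball_iff_norm] at hz
    have := norm_add_le (z - z₀) z₀
    rw [sub_add_cancel] at this
    rw [mem_ball_zero_iff]; linarith
  have hdist : ∀ z ∈ Metric.ball z₀ d, ∀ ζ : Circle, d ≤ ‖(ζ : ℂ) - z‖ := by
    intro z hz ζ
    rw [mem_ball_iff_norm] at hz
    have := norm_add_le (z - z₀) z₀
    have h2 := norm_sub_norm_le (ζ : ℂ) z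
    rw [sub_add_cancel] at this
    rw [Circle.norm_coe] at h2
    linarith
  have := (hasDerivAt_integral_of_dominated_loc_of_deriv_le (μ := μ) (𝕜 := ℂ)
    (F := fun z (ζ : Circle) => ((ζ : ℂ) + z) / ((ζ : ℂ) - z))
    (F' := fun z (ζ : Circle) => 2 * (ζ : ℂ) / ((ζ : ℂ) - z) ^ 2) (x₀ := z₀)
    (bound := fun _ => 2 / d ^ 2) (Metric.ball_mem_nhds z₀ hd0) ?_ ?_ ?_ ?_ ?_ ?_).2
  · exact this.differentiableAt.differentiableWithinAt
  · filter_upwards [Metric.ball_mem_nhds z₀ hd0] with z hz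
    exact (continuous_herglotzKernel (hsub z hz)).aestronglyMeasurable
  · exact (continuous_herglotzKernel hz₀).integrable_of_compactSpace μ
  · exact (Continuous.div (by fun_prop) (by fun_prop)
      fun ζ => pow_ne_zero 2 (coe_sub_ne_zero hz₀ ζ)).aestronglyMeasurable
  · refine ae_of_all _ fun ζ z hz => ?_
    rw [norm_div, norm_mul, norm_pow, Circle.norm_coe, mul_one, Complex.norm_ofNat]
    gcongr
    exact hdist z hz ζ
  · exact integrable_const _
  · refine ae_of_all _ fun ζ z hz => ?_
    have h := ((hasDerivAt_id' z).const_add (ζ : ℂ)).div ((hasDerivAt_id' z).const_sub (ζ : ℂ))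
      (coe_sub_ne_zero (hsub z hz) ζ)
    exact h.congr_deriv (by congr 1; ring)

/-- The Herglotz representation of a holomorphic function with nonnegative real part. -/
theorem exists_measure_eq_integral_herglotzKernel {f : ℂ → ℂ}
    (hf : DifferentiableOn ℂ f (Metric.ball 0 1))
    (hre : ∀ z ∈ Metric.ball (0 : ℂ) 1, 0 ≤ (f z).re) :
    ∃ (μ : Measure Circle) (l : ℝ), IsFiniteMeasure μ ∧ ∀ z ∈ Metric.ball (0 : ℂ) 1,
      f z = (∫ ζ : Circle, ((ζ : ℂ) + z) / ((ζ : ℂ) - z) ∂μ) + l * Complex.I := by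
  obtain ⟨μ, hμ, h⟩ := exists_measure_re_eq_integral hf hre
  have hdiff := hf.sub (differentiableOn_integral_herglotzKernel μ)
  -- The difference has zero real part, hence is an imaginary constant.
  obtain ⟨c, hc⟩ := (hdiff.analyticOnNhd Metric.isOpen_ball).eq_re_add_const_mul_I_of_re_eq_const
    (c₀ := 0) (fun z hz => by
      rw [Pi.sub_apply, Complex.sub_re, re_integral_herglotzKernel μ hz, h z hz, sub_self])
    Metric.isOpen_ball
    ((convex_ball (0 : ℂ) 1).isConnected ⟨0, by simp⟩)
  refine ⟨μ, c, hμ, fun z hz => ?_⟩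
  have := hc z hz
  simp only [Pi.sub_apply, Complex.ofReal_zero, zero_add] at this
  linear_combination this

/-! ### Radial limits of bounded functions and of logarithms -/

theorem ae_exists_tendsto_re {f : ℂ → ℂ} (hf : DifferentiableOn ℂ f (Metric.ball 0 1))
    {C : ℝ} (hre : ∀ z ∈ Metric.ball (0 : ℂ) 1, -C ≤ (f z).re) :
    ∀ᵐ ζ : Circle ∂circleLebesgue,
      ∃ x : ℝ, Tendsto (fun r : ℝ => (f (r * ζ)).re) (𝓝[<] 1) (𝓝 x) := by
  obtain ⟨μ, hμ, h⟩ := exists_measure_re_eq_integral (hf.add_const (C : ℂ))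
    (fun z hz => by have := hre z hz; simp only [Complex.add_re, Complex.ofReal_re]; linarith)
  filter_upwards [ae_tendsto_integral_poissonKernel μ] with ζ hζ
  refine ⟨_, (hζ.sub_const C).congr' ?_⟩
  filter_upwards [eventually_nhdsLT_one] with r hr
  rw [← h _ (real_mul_coe_mem_ball hr.1 hr.2 ζ)]
  simp

/-- Bounded holomorphic functions on the disk have radial limits almost everywhere. -/
theorem ae_exists_tendsto_radial {f : ℂ → ℂ} (hf : DifferentiableOn ℂ f (Metric.ball 0 1))
    {C : ℝ} (hC : ∀ z ∈ Metric.ball (0 : ℂ) 1, ‖f z‖ ≤ C) :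
    ∀ᵐ ζ : Circle ∂circleLebesgue,
      ∃ w : ℂ, Tendsto (fun r : ℝ => f (r * ζ)) (𝓝[<] 1) (𝓝 w) := by
  filter_upwards [ae_exists_tendsto_re hf (C := C) fun z hz =>
      neg_le_of_abs_le ((Complex.abs_re_le_norm _).trans (hC z hz)),
    ae_exists_tendsto_re (hf.const_mul (-Complex.I)) (C := C) fun z hz =>
      neg_le_of_abs_le ((Complex.abs_re_le_norm _).trans (by simpa using hC z hz))]
    with ζ ⟨x, hx⟩ ⟨y, hy⟩
  refine ⟨x + y * Complex.I, ?_⟩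
  have h1 := (Complex.continuous_ofReal.tendsto _).comp hx
  have h2 := (Complex.continuous_ofReal.tendsto _).comp hy
  refine (h1.add (h2.mul_const Complex.I)).congr fun r => ?_
  simp [Complex.re_add_im]

/-- If `exp ∘ γ` has a nonzero limit at the end of a path `γ`, then so has `γ`. -/
theorem exists_tendsto_of_tendsto_exp {γ : ℝ → ℂ} (hγ : ContinuousOn γ (Ioo 0 1)) {w : ℂ}
    (hw : w ≠ 0) (h : Tendsto (fun r => Complex.exp (γ r)) (𝓝[<] 1) (𝓝 w)) :
    ∃ α, Complex.exp α = w ∧ Tendsto γ (𝓝[<] 1) (𝓝 α) := by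
  have hq : Tendsto (fun r => Complex.exp (γ r) / w) (𝓝[<] 1) (𝓝 1) := by
    simpa [hw] using h.div_const w
  have hslit : ∀ᶠ r in 𝓝[<] (1 : ℝ), Complex.exp (γ r) / w ∈ Complex.slitPlane :=
    hq.eventually (Complex.isOpen_slitPlane.mem_nhds Complex.one_mem_slitPlane)
  obtain ⟨c, hc, hcs⟩ := (mem_nhdsLT_iff_exists_Ioo_subset).1 (hslit.and eventually_nhdsLT_one)
  rw [mem_Iio] at hc
  -- `k` compares `γ` with a branch of the logarithm of `exp ∘ γ` near `w`; it is continuous with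
  -- values in `2πiℤ`, hence constant.
  set k : ℝ → ℂ := fun r => γ r - Complex.log w - Complex.log (Complex.exp (γ r) / w) with hk
  have hkc : ContinuousOn k (Ioo c 1) := by
    have hγ' : ContinuousOn γ (Ioo c 1) := hγ.mono fun r hr => (hcs hr).2
    exact (hγ'.sub continuousOn_const).sub
      (((Complex.continuous_exp.comp_continuousOn hγ').div_const w).clog fun r hr => (hcs hr).1)
  have hkn : ∀ r, ∃ n : ℤ, k r = n * (2 * Real.pi * Complex.I) := by
    intro r
    rw [← Complex.exp_eq_one_iff, hk]
    simp only [Complex.exp_sub]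
    rw [Complex.exp_log hw, Complex.exp_log (div_ne_zero (Complex.exp_ne_zero _) hw),
      div_self (div_ne_zero (Complex.exp_ne_zero _) hw)]
  have him : ∀ r, ∀ n : ℤ, k r = n * (2 * Real.pi * Complex.I) → (k r).im / (2 * Real.pi) = n := by
    intro r n hn
    rw [hn]
    have : ((n : ℂ) * (2 * Real.pi * Complex.I)).im = n * (2 * Real.pi) := by simp
    rw [this]
    field_simp
  have hlt : ∀ r ∈ Ioo c 1, ∀ s ∈ Ioo c 1, ∀ n m : ℤ, k r = n * (2 * Real.pi * Complex.I) →
      k s = m * (2 * Real.pi * Complex.I) → ¬ n < m := by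
    intro r hr s hs n m hn hm hnm
    have hcim : ContinuousOn (fun r => (k r).im / (2 * Real.pi)) (Ioo c 1) :=
      (Complex.continuous_im.comp_continuousOn hkc).div_const _
    obtain ⟨u, hu, hu'⟩ := isPreconnected_Ioo.intermediate_value hr hs hcim
      (show (n : ℝ) + 1 / 2 ∈ Icc _ _ by
        rw [him r n hn, him s m hm]
        have : (n : ℝ) + 1 ≤ m := by exact_mod_cast hnm
        constructor <;> linarith)
    obtain ⟨p, hp⟩ := hkn u
    simp only [him u p hp] at hu'
    have h2 : (2 * p : ℝ) = 2 * n + 1 := by linarith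
    have h3 : 2 * p = 2 * n + 1 := by exact_mod_cast h2
    omega
  obtain ⟨r₀, hr₀⟩ := nonempty_Ioo.2 hc
  obtain ⟨n, hn⟩ := hkn r₀
  have hconst : ∀ r ∈ Ioo c 1, k r = n * (2 * Real.pi * Complex.I) := by
    intro r hr
    obtain ⟨m, hm⟩ := hkn r
    have h1 := hlt r hr r₀ hr₀ m n hm hn
    have h2 := hlt r₀ hr₀ r hr n m hn hm
    rw [hm, le_antisymm (not_lt.1 h2) (not_lt.1 h1)]
  have hlim : Tendsto γ (𝓝[<] 1) (𝓝 (n * (2 * Real.pi * Complex.I) + Complex.log w +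
      Complex.log 1)) := by
    refine (tendsto_const_nhds.add (hq.clog Complex.one_mem_slitPlane)).congr' ?_
    filter_upwards [Ioo_mem_nhdsLT hc] with r hr
    rw [← hconst r hr, hk]
    ring
  exact ⟨_, tendsto_nhds_unique ((Complex.continuous_exp.tendsto _).comp hlim) h, hlim⟩

/-! ### The formula defines a semigroup of inner functions -/

/-- The exponent of the semigroup with parameters `μ` and `l`. -/
noncomputable def generator (μ : Measure Circle) (l : ℝ) (z : ℂ) : ℂ :=
  Complex.I * l - ∫ ζ : Circle, ((ζ : ℂ) + z) / ((ζ : ℂ) - z) ∂μ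

theorem expFormula_eq (μ : Measure Circle) (l : ℝ) (t : ℝ≥0) (z : ℂ) :
    expFormula μ l t z = Complex.exp ((t : ℝ) * generator μ l z) := by
  rw [expFormula, ← Complex.exp_add, generator]
  congr 1
  ring

theorem differentiableOn_generator (μ : Measure Circle) [IsFiniteMeasure μ] (l : ℝ) :
    DifferentiableOn ℂ (generator μ l) (Metric.ball 0 1) :=
  (differentiableOn_integral_herglotzKernel μ).const_sub _

theorem re_generator (μ : Measure Circle) [IsFiniteMeasure μ] (l : ℝ) {z : ℂ}
    (hz : z ∈ Metric.ball (0 : ℂ) 1) :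
    (generator μ l z).re = -∫ ζ : Circle, poissonKernel 0 z ζ ∂μ := by
  rw [generator, Complex.sub_re, re_integral_herglotzKernel μ hz]
  simp

theorem re_generator_nonpos (μ : Measure Circle) [IsFiniteMeasure μ] (l : ℝ) {z : ℂ}
    (hz : z ∈ Metric.ball (0 : ℂ) 1) : (generator μ l z).re ≤ 0 := by
  rw [re_generator μ l hz, neg_nonpos]
  exact integral_nonneg fun ζ => poissonKernel_nonneg hz ζ

theorem norm_exp_mul_le_one {a : ℂ} (ha : a.re ≤ 0) (t : ℝ≥0) :
    ‖Complex.exp ((t : ℝ) * a)‖ ≤ 1 := by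
  rw [Complex.norm_exp, Real.exp_le_one_iff, Complex.re_ofReal_mul]
  exact mul_nonpos_of_nonneg_of_nonpos t.2 ha

/-- Singularity sends the real part to zero, by Fatou. The bounded function `exp (generator μ l)`
then has a unimodular, hence nonzero, radial limit, which lifts to the exponent. The exceptional
null set does not depend on `t`. -/
theorem ae_exists_tendsto_generator (μ : Measure Circle) [IsFiniteMeasure μ]
    (hμ : μ ⟂ₘ circleLebesgue) (l : ℝ) :
    ∀ᵐ ζ : Circle ∂circleLebesgue, ∃ α : ℂ, α.re = 0 ∧
      Tendsto (fun r : ℝ => generator μ l (r * ζ)) (𝓝[<] 1) (𝓝 α) := by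
  have hd := differentiableOn_generator μ l
  filter_upwards [ae_exists_tendsto_radial hd.cexp (C := 1) fun z hz => by
      simpa using norm_exp_mul_le_one (re_generator_nonpos μ l hz) 1,
    ae_tendsto_integral_poissonKernel μ, hμ.rnDeriv_ae_eq_zero] with ζ ⟨w, hw⟩ hP h0
  rw [h0, Pi.zero_apply, ENNReal.toReal_zero, mul_zero] at hP
  have hre : Tendsto (fun r : ℝ => (generator μ l (r * ζ)).re) (𝓝[<] 1) (𝓝 0) := by
    rw [← neg_zero]
    refine hP.neg.congr' ?_
    filter_upwards [eventually_nhdsLT_one] with r hr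
    rw [re_generator μ l (real_mul_coe_mem_ball hr.1 hr.2 ζ)]
  have hnorm : ‖w‖ = 1 := by
    have h2 : Tendsto (fun r : ℝ => ‖Complex.exp (generator μ l (r * ζ))‖) (𝓝[<] 1) (𝓝 1) := by
      simp only [Complex.norm_exp]
      simpa [Function.comp_def] using (Real.continuous_exp.tendsto _).comp hre
    exact tendsto_nhds_unique hw.norm h2
  obtain ⟨α, -, hα⟩ := exists_tendsto_of_tendsto_exp
    (γ := fun r : ℝ => generator μ l (r * ζ))
    (hd.continuousOn.comp (by fun_prop) fun r hr => real_mul_coe_mem_ball hr.1 hr.2 ζ)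
    (norm_ne_zero_iff.1 (by rw [hnorm]; exact one_ne_zero)) hw
  exact ⟨α, tendsto_nhds_unique ((Complex.continuous_re.tendsto _).comp hα) hre, hα⟩

theorem exists_seq_tendsto_nhdsLT_one :
    ∃ r : ℕ → ℝ, (∀ n, 0 < r n ∧ r n < 1) ∧ Tendsto r atTop (𝓝[<] 1) := by
  obtain ⟨r, -, hr, hlim⟩ := exists_seq_strictMono_tendsto' (show (0 : ℝ) < 1 from one_pos)
  exact ⟨r, hr, tendsto_nhdsWithin_iff.2 ⟨hlim, Eventually.of_forall fun n => (hr n).2⟩⟩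

theorem IsInner.ae_tendsto {φ : ℂ → ℂ} (h : IsInner φ) :
    ∀ᵐ ζ : Circle ∂circleLebesgue,
      Tendsto (fun r : ℝ => φ (r * ζ)) (𝓝[<] 1) (𝓝 (boundaryValue φ ζ)) ∧
        ‖boundaryValue φ ζ‖ = 1 := by
  filter_upwards [h.unimodular] with ζ ⟨w, hw, hw1⟩
  have : boundaryValue φ ζ = w := hw.limUnder_eq
  rw [this]
  exact ⟨hw, hw1⟩

theorem IsInner.aestronglyMeasurable_boundaryValue {φ : ℂ → ℂ} (h : IsInner φ) :
    AEStronglyMeasurable (boundaryValue φ) circleLebesgue := by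
  obtain ⟨r, hr, hlim⟩ := exists_seq_tendsto_nhdsLT_one
  refine aestronglyMeasurable_of_tendsto_ae atTop (f := fun n (ζ : Circle) => φ (r n * ζ))
    (fun n => (continuous_radial h.analytic (hr n).1 (hr n).2).aestronglyMeasurable) ?_
  filter_upwards [h.ae_tendsto] with ζ hζ
  exact hζ.1.comp hlim

theorem isInnerSemigroup_expFormula (μ : Measure Circle) [IsFiniteMeasure μ]
    (hμ : μ ⟂ₘ circleLebesgue) (l : ℝ) : IsInnerSemigroup (expFormula μ l) := by
  have hlim := ae_exists_tendsto_generator μ hμ l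
  have htend : ∀ {ζ : Circle} {α : ℂ} (t : ℝ≥0),
      Tendsto (fun r : ℝ => generator μ l (r * ζ)) (𝓝[<] 1) (𝓝 α) →
      Tendsto (fun r : ℝ => expFormula μ l t (r * ζ)) (𝓝[<] 1)
        (𝓝 (Complex.exp ((t : ℝ) * α))) := by
    intro ζ α t h
    simp only [expFormula_eq]
    exact (Complex.continuous_exp.tendsto _).comp (h.const_mul _)
  have hinner : ∀ t, IsInner (expFormula μ l t) := by
    intro t
    refine ⟨?_, ⟨1, fun z hz => ?_⟩, ?_⟩
    · simp only [funext (expFormula_eq μ l t)]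
      exact ((differentiableOn_generator μ l).const_mul _).cexp
    · rw [expFormula_eq]
      exact norm_exp_mul_le_one (re_generator_nonpos μ l hz) t
    · filter_upwards [hlim] with ζ ⟨α, hα, h⟩
      refine ⟨_, htend t h, ?_⟩
      rw [Complex.norm_exp, Complex.re_ofReal_mul, hα, mul_zero, Real.exp_zero]
  refine ⟨hinner, fun s t z _ => ?_, fun g hg => ?_⟩
  · rw [expFormula_eq, expFormula_eq, expFormula_eq, ← Complex.exp_add]
    congr 1
    push_cast
    ring
  · refine continuous_of_dominated (bound := fun ζ => ‖g ζ‖)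
      (fun t => (hinner t).aestronglyMeasurable_boundaryValue.mul hg.aestronglyMeasurable)
      (fun t => ?_) hg.norm ?_
    · filter_upwards [(hinner t).ae_tendsto] with ζ hζ
      rw [norm_mul, hζ.2, one_mul]
    -- Off one null set, the boundary values are `exp (t * α)` for all `t` simultaneously, hence
    -- continuous in `t`.
    · filter_upwards [hlim] with ζ ⟨α, hα, h⟩
      have : ∀ t, boundaryValue (expFormula μ l t) ζ = Complex.exp ((t : ℝ) * α) :=
        fun t => (htend t h).limUnder_eq
      simp only [this]
      fun_prop

/-! ### From boundary values to values in the disk -/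

/-- An inner function is the Poisson integral of its boundary values. -/
theorem IsInner.integral_poissonKernel_mul {φ : ℂ → ℂ} (h : IsInner φ) {z : ℂ}
    (hz : z ∈ Metric.ball (0 : ℂ) 1) :
    ∫ ζ : Circle, (poissonKernel 0 z ζ : ℂ) * boundaryValue φ ζ ∂circleLebesgue =
      2 * Real.pi * φ z := by
  obtain ⟨r, hr, hlim⟩ := exists_seq_tendsto_nhdsLT_one
  obtain ⟨C, hC⟩ := h.bounded
  have hPc := Complex.continuous_ofReal.comp (continuous_poissonKernel hz)
  have h1 : Tendsto (fun n => ∫ ζ : Circle, (poissonKernel 0 z ζ : ℂ) * φ (r n * ζ)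
      ∂circleLebesgue) atTop
      (𝓝 (∫ ζ : Circle, (poissonKernel 0 z ζ : ℂ) * boundaryValue φ ζ ∂circleLebesgue)) := by
    refine tendsto_integral_of_dominated_convergence
      (fun ζ => ‖(poissonKernel 0 z ζ : ℂ)‖ * C) (fun n => ?_) ?_ (fun n => ?_) ?_
    · exact (hPc.mul (continuous_radial h.analytic (hr n).1 (hr n).2)).aestronglyMeasurable
    · exact (hPc.norm.mul continuous_const).integrable_of_compactSpace _
    · refine ae_of_all _ fun ζ => ?_
      rw [norm_mul]
      gcongr
      exact hC _ (real_mul_coe_mem_ball (hr n).1 (hr n).2 ζ)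
    · filter_upwards [h.ae_tendsto] with ζ hζ
      exact (hζ.1.comp hlim).const_mul _
  have h2 : Tendsto (fun n => 2 * Real.pi * φ (r n * z)) atTop (𝓝 (2 * Real.pi * φ z)) := by
    have hcz : ContinuousAt φ z :=
      h.analytic.continuousOn.continuousAt (Metric.isOpen_ball.mem_nhds hz)
    refine (hcz.tendsto.comp ?_).const_mul _
    have : Tendsto (fun n => (r n : ℂ) * z) atTop (𝓝 ((1 : ℝ) * z)) :=
      ((Complex.continuous_ofReal.tendsto _).comp
        (tendsto_nhds_of_tendsto_nhdsWithin hlim)).mul_const z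
    simpa using this
  refine tendsto_nhds_unique h1 (h2.congr fun n => ?_)
  rw [InnerSemigroup.integral_poissonKernel_mul h.analytic (hr n).1 (hr n).2 hz]

/-- The Poisson kernel is positive of total mass `2π` and the boundary values are unimodular, so the
unspecified bound improves to `1`. -/
theorem IsInner.norm_le_one {φ : ℂ → ℂ} (h : IsInner φ) {z : ℂ}
    (hz : z ∈ Metric.ball (0 : ℂ) 1) : ‖φ z‖ ≤ 1 := by
  have h1 : ‖2 * Real.pi * φ z‖ ≤ 2 * Real.pi := by
    rw [← h.integral_poissonKernel_mul hz, ← integral_poissonKernel hz]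
    refine norm_integral_le_of_norm_le ((continuous_poissonKernel hz).integrable_of_compactSpace _)
      ?_
    filter_upwards [h.ae_tendsto] with ζ hζ
    rw [norm_mul, hζ.2, mul_one, Complex.norm_real, Real.norm_of_nonneg (poissonKernel_nonneg hz ζ)]
  have hpi := Real.pi_pos
  rw [norm_mul, norm_mul, Complex.norm_real, Complex.norm_ofNat, Real.norm_of_nonneg hpi.le] at h1
  nlinarith

theorem IsInnerSemigroup.continuous_apply {φ : ℝ≥0 → ℂ → ℂ} (h : IsInnerSemigroup φ) {z : ℂ}
    (hz : z ∈ Metric.ball (0 : ℂ) 1) : Continuous fun t => φ t z := by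
  have h1 := h.weakStarContinuous (fun ζ => (poissonKernel 0 z ζ : ℂ))
    ((Complex.continuous_ofReal.comp (continuous_poissonKernel hz)).integrable_of_compactSpace _)
  have hpi : (2 * Real.pi : ℂ) ≠ 0 := by simp [Real.pi_ne_zero]
  have h2 : ∀ t, φ t z = (2 * Real.pi : ℂ)⁻¹ *
      ∫ ζ : Circle, boundaryValue (φ t) ζ * (poissonKernel 0 z ζ : ℂ) ∂circleLebesgue := by
    intro t
    simp only [mul_comm (boundaryValue _ _)]
    rw [(h.inner t).integral_poissonKernel_mul hz, inv_mul_cancel_left₀ hpi]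
  simp only [h2]
  exact continuous_const.mul h1

/-- The boundary function of `φ 0` is idempotent and unimodular, hence `1` almost everywhere; the
Poisson integral carries this inside. -/
theorem IsInnerSemigroup.zero_apply {φ : ℝ≥0 → ℂ → ℂ} (h : IsInnerSemigroup φ) {z : ℂ}
    (hz : z ∈ Metric.ball (0 : ℂ) 1) : φ 0 z = 1 := by
  have h1 : ∀ᵐ ζ : Circle ∂circleLebesgue, boundaryValue (φ 0) ζ = 1 := by
    filter_upwards [(h.inner 0).ae_tendsto] with ζ ⟨hζ, hn⟩
    have hsq : boundaryValue (φ 0) ζ = boundaryValue (φ 0) ζ * boundaryValue (φ 0) ζ := by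
      refine tendsto_nhds_unique hζ ((hζ.mul hζ).congr' ?_)
      filter_upwards [eventually_nhdsLT_one] with r hr
      rw [← h.mul 0 0 _ (real_mul_coe_mem_ball hr.1 hr.2 ζ), add_zero]
    have hne : boundaryValue (φ 0) ζ ≠ 0 := norm_ne_zero_iff.1 (by rw [hn]; exact one_ne_zero)
    exact (mul_eq_left₀ hne).1 hsq.symm
  have h2 := (h.inner 0).integral_poissonKernel_mul hz
  rw [integral_congr_ae (g := fun ζ : Circle => ((poissonKernel 0 z ζ : ℝ) : ℂ))
    (h1.mono fun ζ hζ => by simp only [hζ, mul_one])] at h2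
  have h3 : ∫ ζ : Circle, ((poissonKernel 0 z ζ : ℝ) : ℂ) ∂circleLebesgue =
      ((∫ ζ : Circle, poissonKernel 0 z ζ ∂circleLebesgue : ℝ) : ℂ) := integral_ofReal
  rw [h3, integral_poissonKernel hz] at h2
  have hpi : (2 * Real.pi : ℂ) ≠ 0 := by simp [Real.pi_ne_zero]
  push_cast at h2
  exact (mul_eq_left₀ hpi).1 h2.symm

/-! ### Existence of the generator, its measure and its rotation constant -/

/-- The Laplace transform at `1`. -/
noncomputable def laplaceOne (c : ℝ≥0 → ℂ) : ℂ :=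
  ∫ s in Ioi (0 : ℝ), Complex.exp (-s) * c s.toNNReal

theorem integrableOn_exp_neg : IntegrableOn (fun s : ℝ => Real.exp (-s)) (Ioi 0) := by
  simpa using integrableOn_exp_mul_Ioi (a := -1) (by norm_num) 0

theorem norm_exp_neg_mul_le {s : ℝ} {w : ℂ} {C : ℝ} (hw : ‖w‖ ≤ C) :
    ‖Complex.exp (-s) * w‖ ≤ Real.exp (-s) * C := by
  rw [norm_mul, Complex.norm_exp, Complex.neg_re, Complex.ofReal_re]
  gcongr

/-- A contractive continuous multiplicative semigroup of complex numbers is exponential, with a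
generator expressed by the Laplace transform. -/
theorem semigroup_eq_exp {c : ℝ≥0 → ℂ} (hc : Continuous c) (h0 : c 0 = 1)
    (hmul : ∀ s t, c (s + t) = c s * c t) (hb : ∀ t, ‖c t‖ ≤ 1) :
    laplaceOne c ≠ 0 ∧ ∀ t : ℝ≥0, c t = Complex.exp ((t : ℝ) * (1 - (laplaceOne c)⁻¹)) := by
  set L := laplaceOne c with hL
  set b : ℝ → ℂ := fun s => Complex.exp (-s) * c s.toNNReal with hbdef
  have hbc : Continuous b := by
    have : Continuous fun s : ℝ => c s.toNNReal := hc.comp continuous_real_toNNReal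
    fun_prop
  have hbint : IntegrableOn b (Ioi 0) := by
    refine integrableOn_exp_neg.mono' hbc.aestronglyMeasurable (ae_of_all _ fun s => ?_)
    rw [← mul_one (Real.exp (-s))]
    exact norm_exp_neg_mul_le (hb s.toNNReal)
  have hbmul : ∀ s t : ℝ, 0 ≤ s → 0 ≤ t → b (t + s) = b t * b s := by
    intro s t hs ht
    simp only [hbdef]
    rw [Real.toNNReal_add ht hs, hmul]
    push_cast
    rw [neg_add, Complex.exp_add]
    ring
  have hb0 : b 0 = 1 := by simp [hbdef, h0]
  -- The tail integral of `b` over `(t, ∞)`; the semigroup law turns it into `b t * L`.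
  set B : ℝ → ℂ := fun t => L - ∫ s in (0 : ℝ)..t, b s with hB
  have hBderiv : ∀ t, HasDerivAt B (-b t) t := fun t =>
    (hbc.integral_hasStrictDerivAt 0 t).hasDerivAt.const_sub L
  have hBb : ∀ t, 0 ≤ t → B t = b t * L := by
    intro t ht
    have e1 : b t * L = ∫ s in Ioi (0 : ℝ), b (t + s) := by
      rw [hL, laplaceOne, ← integral_const_mul]
      exact setIntegral_congr_fun measurableSet_Ioi fun s hs => (hbmul s t (le_of_lt hs) ht).symm
    have e2 : ∫ s in Ioi (0 : ℝ), b (t + s) = ∫ s in Ioi t, b s := by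
      have := (measurePreserving_add_left volume t).setIntegral_preimage_emb
        (measurableEmbedding_addLeft t) b (Ioi t)
      simpa using this
    have e3 := intervalIntegral.integral_interval_add_Ioi hbint
      (hbint.mono_set (Ioi_subset_Ioi ht))
    rw [e1, e2, hB, hL, laplaceOne]
    simp only
    rw [← e3]
    ring
  -- If `L = 0` then `B` vanishes on `[0, ∞)`, while its derivative at `0` is `-b 0 = -1`.
  have hL0 : L ≠ 0 := by
    intro hL0
    have h1 : HasDerivWithinAt B 0 (Ici 0) 0 :=
      (hasDerivWithinAt_const (0 : ℝ) (Ici 0) (0 : ℂ)).congr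
        (fun t ht => by rw [hBb t ht, hL0, mul_zero]) (by rw [hBb 0 le_rfl, hL0, mul_zero])
    have h2 := (uniqueDiffWithinAt_Ici (0 : ℝ)).eq_deriv _ h1 (hBderiv 0).hasDerivWithinAt
    rw [hb0] at h2
    norm_num at h2
  refine ⟨hL0, fun t => ?_⟩
  -- `B' = -b = -B / L` on `[0, ∞)`, so this integrating factor makes `G` constant there.
  set G : ℝ → ℂ := fun s => B s * Complex.exp (s * L⁻¹) with hG
  have hexp : ∀ s : ℝ, HasDerivAt (fun s : ℝ => Complex.exp (s * L⁻¹))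
      (Complex.exp (s * L⁻¹) * (1 * L⁻¹)) s := fun s =>
    (((hasDerivAt_id (s : ℂ)).mul_const L⁻¹).cexp).comp_ofReal
  have hGd : ∀ s : ℝ, HasDerivAt G
      (-b s * Complex.exp (s * L⁻¹) + B s * (Complex.exp (s * L⁻¹) * (1 * L⁻¹))) s := fun s =>
    (hBderiv s).mul (hexp s)
  have hGconst := constant_of_has_deriv_right_zero (f := G) (a := 0) (b := t)
    (fun s _ => (hGd s).continuousAt.continuousWithinAt) (fun s hs => by
      have := (hGd s).hasDerivWithinAt (s := Ici s)
      rw [hBb s hs.1] at this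
      convert this using 1
      field_simp
      ring) (t : ℝ) ⟨t.2, le_rfl⟩
  simp only [hG, hBb 0 le_rfl, hBb t t.2, hb0] at hGconst
  simp only [Complex.ofReal_zero, zero_mul, Complex.exp_zero, mul_one, one_mul, hbdef,
    Real.toNNReal_coe] at hGconst
  have h3 : Complex.exp (-(t : ℝ)) * c t * Complex.exp ((t : ℝ) * L⁻¹) = 1 := by
    apply mul_right_cancel₀ hL0
    rw [one_mul]
    linear_combination hGconst
  rw [mul_sub, mul_one, Complex.exp_sub, eq_div_iff (Complex.exp_ne_zero _)]
  rw [Complex.exp_neg] at h3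
  have h4 := Complex.exp_ne_zero (t : ℝ)
  field_simp at h3
  exact h3

theorem IsInnerSemigroup.differentiableOn_laplaceOne {φ : ℝ≥0 → ℂ → ℂ} (h : IsInnerSemigroup φ) :
    DifferentiableOn ℂ (fun z => laplaceOne fun t => φ t z) (Metric.ball 0 1) := by
  intro z₀ hz₀
  have hz₀' : ‖z₀‖ < 1 := by simpa using hz₀
  set d := (1 - ‖z₀‖) / 2 with hd
  have hd0 : 0 < d := by rw [hd]; linarith
  have hsub : ∀ z ∈ Metric.ball z₀ d, Metric.closedBall z (d / 2) ⊆ Metric.ball (0 : ℂ) 1 := by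
    intro z hz w hw
    rw [mem_ball_iff_norm] at hz
    rw [mem_closedBall_iff_norm] at hw
    have h1 := norm_add_le (z - z₀) z₀
    have h2 := norm_add_le (w - z) z
    rw [sub_add_cancel] at h1 h2
    rw [mem_ball_zero_iff]; linarith
  have hself : ∀ z ∈ Metric.ball z₀ d, z ∈ Metric.ball (0 : ℂ) 1 := fun z hz =>
    hsub z hz (Metric.mem_closedBall_self (by positivity))
  have hcont : ∀ z ∈ Metric.ball (0 : ℂ) 1,
      Continuous fun s : ℝ => Complex.exp (-s) * φ s.toNNReal z := by
    intro z hz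
    have : Continuous fun s : ℝ => φ s.toNNReal z :=
      (h.continuous_apply hz).comp continuous_real_toNNReal
    exact Continuous.mul (by fun_prop) this
  have hderiv : ∀ (s : ℝ), ∀ z ∈ Metric.ball (0 : ℂ) 1,
      HasDerivAt (φ s.toNNReal) (deriv (φ s.toNNReal) z) z := fun s z hz =>
    ((h.inner _).analytic.differentiableAt (Metric.isOpen_ball.mem_nhds hz)).hasDerivAt
  -- Measurability in `s` of the `z`-derivative comes from writing it as a limit of difference
  -- quotients, which are continuous in `s`.
  have hmeas : AEStronglyMeasurable
      (fun s : ℝ => Complex.exp (-s) * deriv (φ s.toNNReal) z₀) (volume.restrict (Ioi 0)) := by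
    set u : ℕ → ℂ := fun n => ((d / (n + 2) : ℝ) : ℂ) with hu
    have hu0 : ∀ n, u n ≠ 0 := fun n => by
      simp only [hu, ne_eq, Complex.ofReal_eq_zero]
      positivity
    have hulim : Tendsto u atTop (𝓝 0) := by
      rw [← Complex.ofReal_zero]
      refine (Complex.continuous_ofReal.tendsto _).comp ?_
      exact tendsto_const_nhds.div_atTop
        (tendsto_atTop_add_const_right _ _ tendsto_natCast_atTop_atTop)
    have humem : ∀ n, z₀ + u n ∈ Metric.ball z₀ d := by
      intro n
      rw [mem_ball_iff_norm, add_sub_cancel_left, hu, Complex.norm_real,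
        Real.norm_of_nonneg (by positivity)]
      have : (0 : ℝ) ≤ n := n.cast_nonneg
      rw [div_lt_iff₀ (by positivity)]
      nlinarith
    refine aestronglyMeasurable_of_tendsto_ae atTop
      (f := fun n (s : ℝ) => (u n)⁻¹ * (Complex.exp (-s) * φ s.toNNReal (z₀ + u n) -
        Complex.exp (-s) * φ s.toNNReal z₀)) (fun n => ?_) (ae_of_all _ fun s => ?_)
    · exact (continuous_const.mul ((hcont _ (hself _ (humem n))).sub
        (hcont _ hz₀))).aestronglyMeasurable
    · have := (hasDerivAt_iff_tendsto_slope_zero.1 (hderiv s z₀ hz₀)).comp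
        (tendsto_nhdsWithin_iff.2 ⟨hulim, Eventually.of_forall hu0⟩)
      refine (this.const_mul (Complex.exp (-s))).congr fun n => ?_
      simp only [Function.comp_apply, smul_eq_mul]
      ring
  have := (hasDerivAt_integral_of_dominated_loc_of_deriv_le (μ := volume.restrict (Ioi (0 : ℝ)))
    (𝕜 := ℂ) (F := fun z (s : ℝ) => Complex.exp (-s) * φ s.toNNReal z)
    (F' := fun z (s : ℝ) => Complex.exp (-s) * deriv (φ s.toNNReal) z) (x₀ := z₀)
    (bound := fun s => Real.exp (-s) * (1 / (d / 2))) (Metric.ball_mem_nhds z₀ hd0)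
    ?_ ?_ hmeas ?_ ?_ ?_).2
  · exact this.differentiableAt.differentiableWithinAt
  · filter_upwards [Metric.ball_mem_nhds z₀ hd0] with z hz
    exact (hcont z (hself z hz)).aestronglyMeasurable
  · refine integrableOn_exp_neg.mono' (hcont z₀ hz₀).aestronglyMeasurable (ae_of_all _ fun s => ?_)
    rw [← mul_one (Real.exp (-s))]
    exact norm_exp_neg_mul_le ((h.inner s.toNNReal).norm_le_one hz₀)
  · refine ae_of_all _ fun s z hz => norm_exp_neg_mul_le ?_
    -- Cauchy's estimate on circles of radius `d / 2`, uniform in `s` since `‖φ_s‖ ≤ 1`.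
    refine Complex.norm_deriv_le_of_forall_mem_sphere_norm_le (by positivity) ?_ fun w hw =>
      (h.inner _).norm_le_one (hsub z hz (Metric.sphere_subset_closedBall hw))
    refine DifferentiableOn.diffContOnCl ?_
    rw [closure_ball _ (by positivity)]
    exact (h.inner _).analytic.mono (hsub z hz)
  · exact integrableOn_exp_neg.mul_const _
  · exact ae_of_all _ fun s z hz => (hderiv s z (hself z hz)).const_mul _

theorem IsInnerSemigroup.exists_eq_expFormula {φ : ℝ≥0 → ℂ → ℂ} (h : IsInnerSemigroup φ) :
    ∃ (μ : Measure Circle) (l : ℝ), IsFiniteMeasure μ ∧ μ ⟂ₘ circleLebesgue ∧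
      ∀ t : ℝ≥0, ∀ z ∈ Metric.ball (0 : ℂ) 1, φ t z = expFormula μ l t z := by
  have hexp := fun z (hz : z ∈ Metric.ball (0 : ℂ) 1) => semigroup_eq_exp
    (h.continuous_apply hz) (h.zero_apply hz) (fun s t => h.mul s t z hz)
    (fun t => (h.inner t).norm_le_one hz)
  obtain ⟨μ, l, hμ, hf⟩ := exists_measure_eq_integral_herglotzKernel
    (f := fun z => (laplaceOne fun t => φ t z)⁻¹ - 1)
    ((h.differentiableOn_laplaceOne.inv fun z hz => (hexp z hz).1).sub_const 1) (by
      intro z hz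
      have h1 := (h.inner 1).norm_le_one hz
      rw [(hexp z hz).2 1, Complex.norm_exp, Real.exp_le_one_iff, NNReal.coe_one,
        Complex.ofReal_one, one_mul, Complex.sub_re] at h1
      rw [Complex.sub_re]
      linarith)
  have hφ : ∀ t : ℝ≥0, ∀ z ∈ Metric.ball (0 : ℂ) 1, φ t z = expFormula μ (-l) t z := by
    intro t z hz
    rw [(hexp z hz).2 t, expFormula_eq, generator]
    congr 2
    have := hf z hz
    push_cast
    linear_combination -this
  refine ⟨μ, -l, hμ, ?_, hφ⟩
  -- The radial limit of `|φ_1|` is both `1` and `exp (-2π dμ/dθ)`, so the density vanishes.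
  rw [← Measure.rnDeriv_eq_zero]
  filter_upwards [(h.inner 1).ae_tendsto, ae_tendsto_integral_poissonKernel μ,
    μ.rnDeriv_ne_top circleLebesgue] with ζ ⟨hζ, hn⟩ hP hfin
  have h1 := (Real.continuous_exp.tendsto _).comp hP.neg
  have h2 := hζ.norm
  rw [hn] at h2
  have h3 := tendsto_nhds_unique h1 (h2.congr' (by
    filter_upwards [eventually_nhdsLT_one] with r hr
    have hm := real_mul_coe_mem_ball hr.1 hr.2 ζ
    rw [hφ 1 _ hm, expFormula_eq, Complex.norm_exp, NNReal.coe_one, Complex.ofReal_one, one_mul,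
      re_generator μ _ hm]
    rfl))
  rw [Real.exp_eq_one_iff, neg_eq_zero, mul_eq_zero, or_iff_right (by positivity),
    ENNReal.toReal_eq_zero_iff, or_iff_left hfin] at h3
  exact h3

/-! ### Uniqueness of the parameters and symmetry -/

theorem eq_of_forall_exp_mul_eq {a b : ℂ}
    (h : ∀ t : ℝ≥0, Complex.exp ((t : ℝ) * a) = Complex.exp ((t : ℝ) * b)) : a = b := by
  -- Small enough that `t * a` and `t * b` have imaginary parts in `(-π, π]`, where `exp` is
  -- injective.
  set t : ℝ≥0 := ⟨(1 + |a.im| + |b.im|)⁻¹, by positivity⟩ with ht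
  have ht0 : (0 : ℝ) < t := show (0 : ℝ) < (1 + |a.im| + |b.im|)⁻¹ by positivity
  have ht1 : (t : ℝ) * (1 + |a.im| + |b.im|) = 1 :=
    inv_mul_cancel₀ (show 1 + |a.im| + |b.im| ≠ 0 by positivity)
  have hbound : ∀ x : ℝ, |x| ≤ 1 + |a.im| + |b.im| → -Real.pi < t * x ∧ t * x ≤ Real.pi := by
    intro x hx
    have h1 : |(t : ℝ) * x| ≤ 1 := by
      rw [abs_mul, abs_of_pos ht0, ← ht1]
      gcongr
    have := abs_le.1 h1
    have := Real.pi_gt_three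
    constructor <;> linarith
  have ha := hbound a.im (by have := abs_nonneg b.im; linarith)
  have hb := hbound b.im (by have := abs_nonneg a.im; linarith)
  have h2 := Complex.exp_inj_of_neg_pi_lt_of_le_pi (x := (t : ℝ) * a) (y := (t : ℝ) * b)
    (by rw [Complex.im_ofReal_mul]; exact ha.1) (by rw [Complex.im_ofReal_mul]; exact ha.2)
    (by rw [Complex.im_ofReal_mul]; exact hb.1) (by rw [Complex.im_ofReal_mul]; exact hb.2) (h t)
  exact mul_left_cancel₀ (Complex.ofReal_ne_zero.2 ht0.ne') h2

/-- The Cauchy transform of a measure on the circle is the generating function of its moments. -/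
theorem hasSum_moments (μ : Measure Circle) [IsFiniteMeasure μ] {z : ℂ}
    (hz : z ∈ Metric.ball (0 : ℂ) 1) :
    HasSum (fun n : ℕ => z ^ n • ∫ ζ : Circle, (ζ : ℂ)⁻¹ ^ n ∂μ)
      ((1 / 2) * ((∫ ζ : Circle, ((ζ : ℂ) + z) / ((ζ : ℂ) - z) ∂μ) +
        ∫ ζ : Circle, ((ζ : ℂ) + 0) / ((ζ : ℂ) - 0) ∂μ)) := by
  have hz' : ‖z‖ < 1 := by simpa using hz
  have hinv : Continuous fun ζ : Circle => (ζ : ℂ)⁻¹ :=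
    Continuous.inv₀ (by fun_prop) fun ζ => ζ.coe_ne_zero
  have hc : ∀ n : ℕ, Continuous fun ζ : Circle => z ^ n * (ζ : ℂ)⁻¹ ^ n := fun n =>
    continuous_const.mul (hinv.pow n)
  have hnorm : ∀ (n : ℕ) (ζ : Circle), ‖z ^ n * (ζ : ℂ)⁻¹ ^ n‖ = ‖z‖ ^ n := by
    intro n ζ
    rw [norm_mul, norm_pow, norm_pow, norm_inv, Circle.norm_coe, inv_one, one_pow, mul_one]
  have h := hasSum_integral_of_summable_integral_norm (μ := μ)
    (F := fun (n : ℕ) (ζ : Circle) => z ^ n * (ζ : ℂ)⁻¹ ^ n)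
    (fun n => (hc n).integrable_of_compactSpace μ) (by
      simp only [hnorm, integral_const, smul_eq_mul]
      exact (summable_geometric_of_lt_one (norm_nonneg z) hz').mul_left _)
  simp only [integral_const_mul] at h
  simp only [smul_eq_mul]
  -- Half of the Herglotz kernel plus its value `1` at `z = 0` is `ζ / (ζ - z)`, a geometric series
  -- in `z / ζ`.
  suffices hval : (1 / 2) * ((∫ ζ : Circle, ((ζ : ℂ) + z) / ((ζ : ℂ) - z) ∂μ) +
      ∫ ζ : Circle, ((ζ : ℂ) + 0) / ((ζ : ℂ) - 0) ∂μ) =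
      ∫ ζ : Circle, ∑' n : ℕ, z ^ n * (ζ : ℂ)⁻¹ ^ n ∂μ by
    rw [hval]
    exact h
  rw [← integral_add ((continuous_herglotzKernel hz).integrable_of_compactSpace μ)
    ((continuous_herglotzKernel (by simp)).integrable_of_compactSpace μ), ← integral_const_mul]
  refine integral_congr_ae (ae_of_all _ fun ζ => ?_)
  simp only [← mul_pow]
  rw [tsum_geometric_of_norm_lt_one (by simpa using (hnorm 1 ζ).trans_lt (by simpa using hz'))]
  have h1 := coe_sub_ne_zero hz ζ
  have h2 := ζ.coe_ne_zero
  have h3 : 1 - z * (ζ : ℂ)⁻¹ = (ζ - z) / ζ := by field_simp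
  rw [h3, inv_div, add_zero, sub_zero, div_self h2]
  field_simp
  ring

theorem moments_eq_of_integral_herglotzKernel_eq {μ ν : Measure Circle} [IsFiniteMeasure μ]
    [IsFiniteMeasure ν]
    (h : ∀ z ∈ Metric.ball (0 : ℂ) 1, ∫ ζ : Circle, ((ζ : ℂ) + z) / ((ζ : ℂ) - z) ∂μ =
      ∫ ζ : Circle, ((ζ : ℂ) + z) / ((ζ : ℂ) - z) ∂ν) (n : ℕ) :
    ∫ ζ : Circle, (ζ : ℂ)⁻¹ ^ n ∂μ = ∫ ζ : Circle, (ζ : ℂ)⁻¹ ^ n ∂ν := by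
  have hps : ∀ τ : Measure Circle, IsFiniteMeasure τ → HasFPowerSeriesAt
      (fun z => (1 / 2) * ((∫ ζ : Circle, ((ζ : ℂ) + z) / ((ζ : ℂ) - z) ∂τ) +
        ∫ ζ : Circle, ((ζ : ℂ) + 0) / ((ζ : ℂ) - 0) ∂τ))
      (FormalMultilinearSeries.ofScalars ℂ fun n : ℕ => ∫ ζ : Circle, (ζ : ℂ)⁻¹ ^ n ∂τ) 0 := by
    intro τ _
    rw [hasFPowerSeriesAt_iff]
    filter_upwards [Metric.ball_mem_nhds (0 : ℂ) one_pos] with z hz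
    simp only [FormalMultilinearSeries.coeff_ofScalars]
    rw [zero_add]
    exact hasSum_moments τ hz
  have heq := (hps μ inferInstance).eq_formalMultilinearSeries_of_eventually (hps ν inferInstance)
    (by
      filter_upwards [Metric.ball_mem_nhds (0 : ℂ) one_pos] with z hz
      rw [h z hz, h 0 (by simp)])
  have := congrArg (fun p => FormalMultilinearSeries.coeff p n) heq
  simpa only [FormalMultilinearSeries.coeff_ofScalars] using this

/-- The star algebra generated by the coordinate function separates points and is spanned by the
powers `ζ ^ n`, `n ∈ ℤ`, because `conj ζ = ζ⁻¹`. -/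
theorem measure_ext_of_moments {μ ν : Measure Circle} [IsFiniteMeasure μ] [IsFiniteMeasure ν]
    (h : ∀ n : ℤ, ∫ ζ : Circle, (ζ : ℂ) ^ n ∂μ = ∫ ζ : Circle, (ζ : ℂ) ^ n ∂ν) : μ = ν := by
  set e : BoundedContinuousFunction Circle ℂ :=
    BoundedContinuousFunction.mkOfCompact ⟨fun ζ : Circle => (ζ : ℂ), by fun_prop⟩ with he
  refine ext_of_forall_mem_subalgebra_integral_eq_of_polish (𝕜 := ℂ)
    (A := StarAlgebra.adjoin ℂ {e}) ?_ fun g hg => ?_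
  · intro x y hxy
    refine ⟨fun ζ => (ζ : ℂ), ⟨BoundedContinuousFunction.toContinuousMapStarₐ ℂ e,
      ⟨e, StarAlgebra.subset_adjoin ℂ {e} rfl, rfl⟩, rfl⟩, ?_⟩
    exact fun hc => hxy (Circle.ext hc)
  · have hg' : g ∈ Subalgebra.toSubmodule (StarAlgebra.adjoin ℂ {e}).toSubalgebra := hg
    rw [StarAlgebra.adjoin_toSubalgebra, Algebra.adjoin_eq_span] at hg'
    clear hg
    induction hg' using Submodule.span_induction with
    | mem g hg =>
      have : ∃ n : ℤ, ∀ ζ : Circle, g ζ = (ζ : ℂ) ^ n := by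
        induction hg using Submonoid.closure_induction with
        | mem g hg =>
          rcases hg with hg | hg
          · exact ⟨1, fun ζ => by rw [mem_singleton_iff.1 hg, zpow_one]; rfl⟩
          · refine ⟨-1, fun ζ => ?_⟩
            have h1 : g = star e := by
              rw [← star_star g]; exact congrArg star (mem_singleton_iff.1 hg)
            rw [h1, zpow_neg_one, ← Circle.coe_inv, Circle.coe_inv_eq_conj]
            rfl
        | one => exact ⟨0, fun ζ => by simp⟩
        | mul f g _ _ hf hg =>
          obtain ⟨n, hn⟩ := hf
          obtain ⟨m, hm⟩ := hg
          refine ⟨n + m, fun ζ => ?_⟩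
          rw [zpow_add₀ ζ.coe_ne_zero, ← hn, ← hm]
          rfl
      obtain ⟨n, hn⟩ := this
      simp only [hn]
      exact h n
    | zero => simp
    | add f g _ _ hf hg =>
      have e1 := integral_add (f.integrable μ) (g.integrable μ)
      have e2 := integral_add (f.integrable ν) (g.integrable ν)
      simp only [BoundedContinuousFunction.add_apply]
      rw [e1, e2, hf, hg]
    | smul c f _ hf =>
      simp only [BoundedContinuousFunction.smul_apply]
      rw [integral_smul, integral_smul, hf]

/-- A finite measure on the circle is determined by its Herglotz transform. -/
theorem measure_ext_of_integral_herglotzKernel {μ ν : Measure Circle} [IsFiniteMeasure μ]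
    [IsFiniteMeasure ν]
    (h : ∀ z ∈ Metric.ball (0 : ℂ) 1, ∫ ζ : Circle, ((ζ : ℂ) + z) / ((ζ : ℂ) - z) ∂μ =
      ∫ ζ : Circle, ((ζ : ℂ) + z) / ((ζ : ℂ) - z) ∂ν) : μ = ν := by
  have hm := moments_eq_of_integral_herglotzKernel_eq h
  refine measure_ext_of_moments fun n => ?_
  rcases Int.eq_nat_or_neg n with ⟨k, rfl | rfl⟩
  -- The Herglotz transform sees only the powers of `ζ⁻¹`; the others are their conjugates, and the
  -- measures are real.
  · have hconj : ∀ ζ : Circle, (ζ : ℂ) ^ (k : ℤ) = conj ((ζ : ℂ)⁻¹ ^ k) := by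
      intro ζ
      rw [← Circle.coe_inv, Circle.coe_inv_eq_conj, map_pow, Complex.conj_conj, zpow_natCast]
    simp only [hconj]
    rw [integral_conj, integral_conj, hm k]
  · simpa using hm k

theorem conj_generator_conj (μ : Measure Circle) (l : ℝ) {z : ℂ}
    (hz : z ∈ Metric.ball (0 : ℂ) 1) :
    conj (generator μ l (conj z)) = generator (μ.map fun ζ : Circle => ζ⁻¹) (-l) z := by
  rw [generator, generator, integral_map continuous_inv.measurable.aemeasurable
    (continuous_herglotzKernel hz).aestronglyMeasurable, map_sub, ← integral_conj, map_mul,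
    Complex.conj_I, Complex.conj_ofReal]
  congr 1
  · push_cast; ring
  · refine integral_congr_ae (ae_of_all _ fun ζ => ?_)
    simp only [map_div₀, map_add, map_sub, Complex.conj_conj, Circle.coe_inv_eq_conj]

theorem isSymmetric_iff (μ : Measure Circle) [IsFiniteMeasure μ] (l : ℝ) :
    (∀ t, IsSymmetric (expFormula μ l t)) ↔ l = 0 ∧ IsConjInvariant μ := by
  have hconj : ∀ t : ℝ≥0, ∀ z ∈ Metric.ball (0 : ℂ) 1, conj (expFormula μ l t (conj z)) =
      Complex.exp ((t : ℝ) * generator (μ.map fun ζ : Circle => ζ⁻¹) (-l) z) := by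
    intro t z hz
    rw [expFormula_eq, ← Complex.exp_conj, map_mul, Complex.conj_ofReal, conj_generator_conj μ l hz]
  constructor
  · intro h
    have hgen : ∀ z ∈ Metric.ball (0 : ℂ) 1,
        generator μ l z = generator (μ.map fun ζ : Circle => ζ⁻¹) (-l) z := by
      intro z hz
      refine eq_of_forall_exp_mul_eq fun t => ?_
      rw [← hconj t z hz, ← h t z hz, expFormula_eq]
    have hl : l = 0 := by
      -- At `z = 0` the kernel is `1` and its integral is real, so the imaginary parts give `l =
      -- -l`.
      have h0 := congrArg Complex.im (hgen 0 (by simp))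
      rw [generator, generator] at h0
      simp at h0
      linarith
    subst hl
    refine ⟨rfl, ?_⟩
    refine measure_ext_of_integral_herglotzKernel fun z hz => ?_
    have := hgen z hz
    rw [generator, generator, neg_zero] at this
    exact (sub_right_injective this).symm
  · rintro ⟨rfl, hμ⟩ t z hz
    rw [hconj t z hz, expFormula_eq, hμ, neg_zero]

end InnerSemigroup

theorem mainTheorem11 :
    -- every semigroup of inner functions is given by the formula
    (∀ φ : ℝ≥0 → ℂ → ℂ, InnerSemigroup.IsInnerSemigroup φ →
      ∃ (μ : Measure Circle) (l : ℝ), IsFiniteMeasure μ ∧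
        μ ⟂ₘ InnerSemigroup.circleLebesgue ∧
        ∀ t : ℝ≥0, ∀ z ∈ Metric.ball (0 : ℂ) 1,
          φ t z = InnerSemigroup.expFormula μ l t z) ∧
    -- every such formula defines a semigroup of inner functions
    (∀ (μ : Measure Circle) (l : ℝ), IsFiniteMeasure μ →
      μ ⟂ₘ InnerSemigroup.circleLebesgue →
      InnerSemigroup.IsInnerSemigroup (InnerSemigroup.expFormula μ l)) ∧
    -- characterization of the symmetric semigroups
    (∀ (φ : ℝ≥0 → ℂ → ℂ) (μ : Measure Circle) (l : ℝ), InnerSemigroup.IsInnerSemigroup φ →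
      IsFiniteMeasure μ → μ ⟂ₘ InnerSemigroup.circleLebesgue →
      (∀ t : ℝ≥0, ∀ z ∈ Metric.ball (0 : ℂ) 1, φ t z = InnerSemigroup.expFormula μ l t z) →
      ((∀ t : ℝ≥0, InnerSemigroup.IsSymmetric (φ t)) ↔
        l = 0 ∧ InnerSemigroup.IsConjInvariant μ)) := by
  refine ⟨fun φ h => h.exists_eq_expFormula,
    fun μ l _ hμ => InnerSemigroup.isInnerSemigroup_expFormula μ hμ l, fun φ μ l _ _ _ hφ => ?_⟩
  rw [← InnerSemigroup.isSymmetric_iff μ l]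
  refine forall_congr' fun t => forall₂_congr fun z hz => ?_
  rw [hφ t z hz, hφ t (conj z) (by simpa using hz)]
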